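/- Let $\alpha>0$ and let $X_1,X_2,\dots$ be i.i.d. random variables with the Pareto distribution function $F(x)=1-x^{-\alpha}$, $x\ge 1$ (the null hypothesis $H_0$). For $n\ge 2$ put $$F_n(t)=\frac1n\sum_{i=1}^n \mathrm I\{X_i\le t\},\qquad M_n(t)=\binom n2^{-1}\sum_{1\le i<j\le n}\mathrm I\Big\{\max\Big(\frac{X_i}{X_j},\frac{X_j}{X_i}\Big)\le t\Big\},\qquad T_n=\int_1^\infty (M_n(t)-F_n(t))\,dF_n(t),$$ where the integral is over $[1,\infty)$. Let $$\Upsilon(x,y,z)=\tfrac13\mathrm I\{\max(\tfrac xy,\tfrac yx)\le z\}+\tfrac13\mathrm I\{\max(\tfrac xz,\tfrac zx)\le y\}+\tfrac13\mathrm I\{\max(\tfrac yz,\tfrac zy)\le x\}-\tfrac12,$$ let $U_n=\binom n3^{-1}\sum_{1\le i<j<k\le n}\Upsilon(X_i,X_j,X_k)$ for $n\ge 3$ be the $U$-statistic of degree $3$ with kernel $\Upsilon$, and let $\upsilon(s)=E\,\Upsilon(s,X_2,X_3)$, so that $\upsilon(X_1)=E(\Upsilon(X_1,X_2,X_3)\mid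 X_1)$ almost surely. Then: 1. $\upsilon(s)=\frac23\,\frac{\alpha\ln s}{s^{\alpha}}-\frac16$ for all $s\ge1$, $E\,\upsilon(X_1)=0$, and $$\sigma^2=\mathrm{Var}(\upsilon(X_1))=\int_1^\infty \upsilon^2(s)\,\alpha s^{-\alpha-1}\,ds=\frac5{972}>0,$$ so the kernel $\Upsilon$ is non-degenerate. 2. $T_n$ and $U_n$ are asymptotically equivalent: $\sqrt n\,(T_n-U_n)\to 0$ in probability as $n\to\infty$. 3. $\sqrt n\,T_n\to \mathcal N\big(0,\tfrac5{108}\big)$ in distribution as $n\to\infty$. -/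

import Mathlib

open MeasureTheory ProbabilityTheory Filter
open scoped ENNReal NNReal

noncomputable section

namespace ParetoTest

/-- The `0`-`1` valued indicator `I{max(x/y, y/x) ≤ z}`. -/
def ratioInd (x y z : ℝ) : ℝ := if max (x / y) (y / x) ≤ z then 1 else 0

/-- The empirical distribution function of the sample `x`. -/
def empCDF {n : ℕ} (x : Fin n → ℝ) (t : ℝ) : ℝ :=
  (n : ℝ)⁻¹ * ∑ i, (if x i ≤ t then (1 : ℝ) else 0)

/-- The measure `dFₙ`: mass `1/n` at each sample point, counted with multiplicity. -/
def empMeasure {n : ℕ} (x : Fin n → ℝ) : Measure ℝ :=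
  (n : ℝ≥0∞)⁻¹ • ∑ i, Measure.dirac (x i)

/-- The `U`-empirical distribution function of `max(X/Y, Y/X)` based on the sample `x`. -/
def ratioEmpCDF {n : ℕ} (x : Fin n → ℝ) (t : ℝ) : ℝ :=
  (n.choose 2 : ℝ)⁻¹ * ∑ i, ∑ j ∈ Finset.Ioi i, ratioInd (x i) (x j) t

/-- The integral-type statistic `∫₁^∞ (Mₙ(t) - Fₙ(t)) dFₙ(t)`. -/
def testStat {n : ℕ} (x : Fin n → ℝ) : ℝ :=
  ∫ t in Set.Ici 1, (ratioEmpCDF x t - empCDF x t) ∂(empMeasure x)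

/-- The symmetric kernel of degree three. -/
def kernel (x y z : ℝ) : ℝ :=
  1 / 3 * ratioInd x y z + 1 / 3 * ratioInd x z y + 1 / 3 * ratioInd y z x - 1 / 2

/-- The `U`-statistic of degree three with kernel `kernel`. -/
def uStat {n : ℕ} (x : Fin n → ℝ) : ℝ :=
  (n.choose 3 : ℝ)⁻¹ *
    ∑ i, ∑ j ∈ Finset.Ioi i, ∑ k ∈ Finset.Ioi j, kernel (x i) (x j) (x k)

/-- The projection `s ↦ E[kernel(s, Y, Z)]`, with `Y`, `Z` independent of law `μ`. -/
def projection (μ : Measure ℝ) (s : ℝ) : ℝ :=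
  ∫ p : ℝ × ℝ, kernel s p.1 p.2 ∂(μ.prod μ)

end ParetoTest

end

/-!
By Hoeffding's decomposition, a symmetric `U`-statistic of degree `k` is its mean, plus `k / n`
times a sum of independent copies of the centred first projection, plus a `U`-statistic with
degenerate kernel. Two terms of the latter whose index sets share at most one index are
uncorrelated, so its second moment is `O(n⁻²)`: it disappears after scaling by `√n`, and the central
limit theorem for the projections remains, with variance `k²` times that of the projection.

For a sample without ties in `[1, ∞)`, the integral against `dFₙ` of `Fₙ` is `(n + 1) / (2 n)`, and
that of `Mₙ` is an average over a pair and a third index. The terms with three distinct indices add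
up to the `U`-statistic, and the others contribute `O(1 / n)`.

For independent Pareto variables `X` and `Y`, `max (X / Y) (Y / X)` has the same Pareto law, which
gives the part of the projection in which the fixed argument is the threshold. When it is one of
the two arguments of the ratio, integrating the Pareto tail yields the logarithmic term.
-/

namespace ParetoTest

section Independence

variable {Ω α β γ : Type*} [MeasurableSpace Ω] [MeasurableSpace α] [MeasurableSpace β]
  [MeasurableSpace γ] {P : Measure Ω} {U : Ω → α} {V : Ω → β} {W : Ω → γ}

lemma condExp_comap_ae_eq_integral_of_indepFun [IsFiniteMeasure P] {f : α × β → ℝ}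
    (hU : Measurable U) (hV : Measurable V) (hUV : IndepFun U V P) (hf : StronglyMeasurable f)
    (hint : Integrable (fun ω => f (U ω, V ω)) P) :
    P[fun ω => f (U ω, V ω) | MeasurableSpace.comap U inferInstance]
      =ᵐ[P] fun ω => ∫ v, f (U ω, v) ∂(P.map V) := by
  have hlaw : P.map (fun ω => (U ω, V ω)) = (P.map U).prod (P.map V) :=
    (indepFun_iff_map_prod_eq_prod_map_map hU.aemeasurable hV.aemeasurable).mp hUV
  have hfprod : Integrable f ((P.map U).prod (P.map V)) := by
    rw [← hlaw]
    exact (integrable_map_measure hf.aestronglyMeasurable (hU.prodMk hV).aemeasurable).mpr hint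
  have hg : StronglyMeasurable fun u => ∫ v, f (u, v) ∂(P.map V) := hf.integral_prod_right'
  have hgint : Integrable (fun ω => ∫ v, f (U ω, v) ∂(P.map V)) P :=
    hfprod.integral_prod_left.comp_measurable hU
  refine (ae_eq_condExp_of_forall_setIntegral_eq hU.comap_le hint
    (fun s _ _ => hgint.integrableOn) ?_
    (hg.comp_measurable (comap_measurable U)).aestronglyMeasurable).symm
  rintro _ ⟨s, hs, rfl⟩ -
  calc ∫ ω in U ⁻¹' s, ∫ v, f (U ω, v) ∂(P.map V) ∂P
      = ∫ u in s, ∫ v, f (u, v) ∂(P.map V) ∂(P.map U) :=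
        (setIntegral_map hs hg.aestronglyMeasurable hU.aemeasurable).symm
    _ = ∫ p in s ×ˢ Set.univ, f p ∂(P.map U).prod (P.map V) := by
        rw [setIntegral_prod f hfprod.integrableOn, Measure.restrict_univ]
    _ = ∫ ω in U ⁻¹' s, f (U ω, V ω) ∂P := by
        rw [← hlaw, setIntegral_map (hs.prod .univ) hf.aestronglyMeasurable
          (hU.prodMk hV).aemeasurable]
        congr 2
        ext ω
        simp

lemma memLp_integral_of_memLp_prod {μ : Measure α} {ν : Measure β} [IsProbabilityMeasure μ]
    [IsProbabilityMeasure ν] {f : α × β → ℝ} {p : ℝ≥0∞} (hp : 1 ≤ p) (hf : StronglyMeasurable f)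
    (hfp : MemLp f p (μ.prod ν)) : MemLp (fun x => ∫ y, f (x, y) ∂ν) p μ := by
  have hcond := condExp_comap_ae_eq_integral_of_indepFun measurable_fst measurable_snd
    (indepFun_prod measurable_id measurable_id) hf (hfp.integrable hp)
  rw [measurePreserving_snd.map_eq] at hcond
  have hcomp : MemLp ((fun x => ∫ y, f (x, y) ∂ν) ∘ Prod.fst) p (μ.prod ν) :=
    (hfp.condExp hp).ae_eq hcond
  rwa [← memLp_map_measure_iff hf.integral_prod_right'.aestronglyMeasurable
    measurable_fst.aemeasurable, measurePreserving_fst.map_eq] at hcomp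

lemma integral_mul_eq_zero_of_indepFun [IsFiniteMeasure P] {f : α → ℝ} {g : β × γ → ℝ}
    (hU : Measurable U) (hV : Measurable V) (hW : Measurable W)
    (hindep : IndepFun (fun ω => (U ω, V ω)) W P) (hf : Measurable f) (hg : Measurable g)
    (hint : Integrable (fun ω => f (U ω) * g (V ω, W ω)) P)
    (hzero : ∀ᵐ v ∂(P.map V), ∫ w, g (v, w) ∂(P.map W) = 0) :
    ∫ ω, f (U ω) * g (V ω, W ω) ∂P = 0 := by
  have hcond := condExp_comap_ae_eq_integral_of_indepFun (f := fun q => f q.1.1 * g (q.1.2, q.2))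
    (hU.prodMk hV) hW hindep (by fun_prop) hint
  rw [← integral_condExp (hU.prodMk hV).comap_le]
  refine integral_eq_zero_of_ae (hcond.trans ?_)
  filter_upwards [ae_of_ae_map hV.aemeasurable hzero] with ω hω
  simp [integral_const_mul, hω]

end Independence

section UStatistic

variable {E : Type*} {k m n : ℕ}

lemma card_filter_subset_map_orderEmbedding {p : Finset (Fin n)} (hp : p.card ≤ k) :
    (Finset.univ.filter fun s : Fin k ↪o Fin n => p ⊆ Finset.univ.map s.toEmbedding).card
      = (n - p.card).choose (k - p.card) := by
  have hcount := Finset.card_filter_powersetCard_subset p Finset.univ k p.subset_univ hp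
  rw [Finset.card_univ, Fintype.card_fin] at hcount
  rw [← hcount]
  refine Finset.card_bij (fun s _ => Finset.univ.map s.toEmbedding) ?_ ?_ ?_
  · simp
  · intro s _ t _ hst
    exact DFunLike.coe_injective (s.strictMono.range_inj t.strictMono |>.mp <| by
      simpa using congrArg ((↑) : Finset (Fin n) → Set (Fin n)) hst)
  · intro q hq
    simp only [Finset.mem_filter, Finset.mem_powersetCard_univ] at hq
    exact ⟨q.orderEmbOfFin hq.1, by simpa using hq.2, by simp⟩

lemma card_orderEmbedding_fin : Fintype.card (Fin k ↪o Fin n) = n.choose k := by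
  simpa using card_filter_subset_map_orderEmbedding (p := (∅ : Finset (Fin n))) k.zero_le

lemma card_filter_two_le_card_inter_le (s : Fin k ↪o Fin n) :
    (Finset.univ.filter fun t : Fin k ↪o Fin n =>
      2 ≤ (Finset.univ.map s.toEmbedding ∩ Finset.univ.map t.toEmbedding).card).card
      ≤ k.choose 2 * (n - 2).choose (k - 2) := by
  let pairs := (Finset.univ.map s.toEmbedding).powersetCard 2
  have hpairs : pairs.card = k.choose 2 := by simp [pairs]
  rw [← hpairs]
  refine le_trans (Finset.card_le_card fun t ht => ?_)
    (Finset.card_biUnion_le_card_mul pairs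
      (fun p => Finset.univ.filter fun t => p ⊆ Finset.univ.map t.toEmbedding) _
      fun p hp => ?_)
  · obtain ⟨p, hsub, hcard⟩ := Finset.exists_subset_card_eq (Finset.mem_filter.mp ht).2
    simp only [Finset.mem_biUnion, Finset.mem_filter, Finset.mem_univ, true_and]
    exact ⟨p, Finset.mem_powersetCard.mpr ⟨hsub.trans Finset.inter_subset_left, hcard⟩,
      hsub.trans Finset.inter_subset_right⟩
  · obtain ⟨hsub, hcard⟩ := Finset.mem_powersetCard.mp hp
    have hk : p.card ≤ k := by simpa using Finset.card_le_card hsub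
    rw [card_filter_subset_map_orderEmbedding hk, hcard]

lemma exists_forall_ne_of_card_inter_lt_two {s : Fin k ↪o Fin n} {t : Fin (m + 1) ↪o Fin n}
    (hcard : (Finset.univ.map s.toEmbedding ∩ Finset.univ.map t.toEmbedding).card < 2) :
    ∃ j₀, ∀ i, ∀ j ≠ j₀, s i ≠ t j := by
  by_cases hmeet : ∃ i j₀, s i = t j₀
  · obtain ⟨i₀, j₀, h₀⟩ := hmeet
    refine ⟨j₀, fun i j hj hij => hj (t.injective ?_)⟩
    exact Finset.card_le_one.mp (Nat.lt_succ_iff.mp hcard) _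
      (by simpa using ⟨i, hij⟩) _ (by simpa using ⟨i₀, h₀⟩)
  · push Not at hmeet
    exact ⟨0, fun i j _ => hmeet i j⟩

lemma sum_orderEmbedding_sum (f : Fin n → ℝ) :
    ∑ s : Fin (m + 1) ↪o Fin n, ∑ i, f (s i) = (n - 1).choose m * ∑ i, f i := by
  calc ∑ s : Fin (m + 1) ↪o Fin n, ∑ i, f (s i)
      = ∑ s : Fin (m + 1) ↪o Fin n, ∑ i,
          if {i} ⊆ Finset.univ.map s.toEmbedding then f i else 0 := by
        refine Finset.sum_congr rfl fun s _ => ?_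
        simp_rw [Finset.singleton_subset_iff]
        rw [← Finset.sum_filter, Finset.filter_mem_eq_inter, Finset.univ_inter, Finset.sum_map]
        rfl
    _ = ∑ i, ∑ s : Fin (m + 1) ↪o Fin n,
          if {i} ⊆ Finset.univ.map s.toEmbedding then f i else 0 := Finset.sum_comm
    _ = (n - 1).choose m * ∑ i, f i := by
        rw [Finset.mul_sum]
        refine Finset.sum_congr rfl fun i _ => ?_
        rw [← Finset.sum_filter, Finset.sum_const,
          card_filter_subset_map_orderEmbedding (by simp), nsmul_eq_mul]
        simp

/-- The `U`-statistic with kernel `h` of the sample `x`: the average of `h` over all choices of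
`k` sample points, each taken in the order of the sample. It is `0` on samples of size
less than `k`. -/
noncomputable def uStatistic (h : (Fin k → E) → ℝ) (x : Fin n → E) : ℝ :=
  (n.choose k : ℝ)⁻¹ * ∑ s : Fin k ↪o Fin n, h (x ∘ s)

lemma uStatistic_sub (h g : (Fin k → E) → ℝ) (x : Fin n → E) :
    uStatistic (h - g) x = uStatistic h x - uStatistic g x := by
  simp [uStatistic, Finset.sum_sub_distrib, mul_sub]

lemma uStatistic_const (hkn : k ≤ n) (c : ℝ) (x : Fin n → E) :
    uStatistic (fun _ : Fin k → E => c) x = c := by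
  have := Nat.cast_ne_zero (R := ℝ).mpr (Nat.choose_pos hkn).ne'
  simp [uStatistic, card_orderEmbedding_fin, inv_mul_cancel_left₀ this]

lemma uStatistic_sum (hmn : m + 1 ≤ n) (f : E → ℝ) (x : Fin n → E) :
    uStatistic (fun v : Fin (m + 1) → E => ∑ i, f (v i)) x = (m + 1) / n * ∑ i, f (x i) := by
  obtain ⟨N, rfl⟩ : ∃ N, n = N + 1 := ⟨n - 1, by omega⟩
  have hchoose : ((N + 1 : ℕ) : ℝ) * (N.choose m : ℝ) = (N + 1).choose (m + 1) * (m + 1) := by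
    exact_mod_cast Nat.add_one_mul_choose_eq N m
  have hpos := Nat.cast_ne_zero (R := ℝ).mpr (Nat.choose_pos hmn).ne'
  rw [uStatistic]
  simp only [Function.comp_apply]
  rw [sum_orderEmbedding_sum fun i => f (x i), Nat.add_sub_cancel]
  field_simp
  linear_combination (∑ i, f (x i)) * hchoose

lemma measurable_uStatistic [MeasurableSpace E] {h : (Fin k → E) → ℝ} (hh : Measurable h) :
    Measurable fun x : Fin n → E => uStatistic h x := by
  unfold uStatistic
  fun_prop

end UStatistic

section Hoeffding

variable {E : Type*} [MeasurableSpace E] {k m n : ℕ} {μ : Measure E}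

/-- The first Hoeffding projection of a kernel `h`: the mean of `h` as a function of its first
argument, the remaining ones being independent with law `μ`. -/
noncomputable def hoeffdingProjection (μ : Measure E) (h : (Fin (m + 1) → E) → ℝ) (x : E) : ℝ :=
  ∫ y, h (Fin.cons x y) ∂Measure.pi fun _ : Fin m => μ

/-- What is left of the kernel `h` after subtracting its mean and its centred first Hoeffding
projection in each argument. -/
noncomputable def hoeffdingResidual (μ : Measure E) (h : (Fin (m + 1) → E) → ℝ)
    (v : Fin (m + 1) → E) : ℝ :=
  h v - ∫ w, h w ∂(Measure.pi fun _ => μ)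
    - ∑ i, (hoeffdingProjection μ h (v i) - ∫ w, h w ∂(Measure.pi fun _ => μ))

/-- A kernel is degenerate if it is centred conditionally on any single argument. -/
def IsDegenerate (μ : Measure E) (g : (Fin (m + 1) → E) → ℝ) : Prop :=
  ∀ j : Fin (m + 1), ∀ᵐ x ∂μ, ∫ y, g (j.insertNth x y) ∂(Measure.pi fun _ : Fin m => μ) = 0

/-- A kernel is symmetric if permuting its arguments does not change it. -/
def IsSymmetric (h : (Fin k → E) → ℝ) : Prop :=
  ∀ (v : Fin k → E) (σ : Equiv.Perm (Fin k)), h (v ∘ σ) = h v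

omit [MeasurableSpace E] in
lemma IsSymmetric.apply_insertNth {h : (Fin (m + 1) → E) → ℝ} (hsymm : IsSymmetric h)
    (j : Fin (m + 1)) (x : E) (y : Fin m → E) : h (j.insertNth x y) = h (Fin.cons x y) := by
  rw [← Fin.cons_comp_cycleRange, hsymm]

variable {h : (Fin (m + 1) → E) → ℝ}

lemma measurePreserving_fin_cons (μ : Measure E) [SigmaFinite μ] :
    MeasurePreserving (fun p : E × (Fin m → E) => (Fin.cons p.1 p.2 : Fin (m + 1) → E))
      (μ.prod (Measure.pi fun _ => μ)) (Measure.pi fun _ => μ) := by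
  simpa [MeasurableEquiv.piFinSuccAbove, Fin.insertNthEquiv] using
    (measurePreserving_piFinSuccAbove (fun _ : Fin (m + 1) => μ) 0).symm

lemma measurable_hoeffdingProjection [IsProbabilityMeasure μ] (hh : Measurable h) :
    Measurable (hoeffdingProjection μ h) := by
  have : StronglyMeasurable fun p : E × (Fin m → E) => h (Fin.cons p.1 p.2) :=
    (hh.comp (measurePreserving_fin_cons μ).measurable).stronglyMeasurable
  exact this.integral_prod_right'.measurable

lemma measurable_hoeffdingResidual [IsProbabilityMeasure μ] (hh : Measurable h) :
    Measurable (hoeffdingResidual μ h) := by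
  have := measurable_hoeffdingProjection (μ := μ) hh
  unfold hoeffdingResidual
  fun_prop

lemma memLp_hoeffdingProjection [IsProbabilityMeasure μ] {p : ℝ≥0∞} (hp : 1 ≤ p)
    (hh : Measurable h) (hhp : MemLp h p (Measure.pi fun _ => μ)) :
    MemLp (hoeffdingProjection μ h) p μ :=
  memLp_integral_of_memLp_prod hp
    (hh.comp (measurePreserving_fin_cons μ).measurable).stronglyMeasurable
    (hhp.comp_measurePreserving (measurePreserving_fin_cons μ))

lemma integral_hoeffdingProjection [IsProbabilityMeasure μ] (hh : Measurable h)
    (hint : Integrable h (Measure.pi fun _ => μ)) :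
    ∫ x, hoeffdingProjection μ h x ∂μ = ∫ v, h v ∂(Measure.pi fun _ => μ) := by
  have hcons := measurePreserving_fin_cons (m := m) μ
  rw [← hcons.map_eq, integral_map hcons.aemeasurable hh.aestronglyMeasurable]
  exact (integral_prod _ (hcons.integrable_comp_of_integrable hint)).symm

lemma isDegenerate_hoeffdingResidual [IsProbabilityMeasure μ] (hh : Measurable h)
    (hint : Integrable h (Measure.pi fun _ => μ)) (hsymm : IsSymmetric h) :
    IsDegenerate μ (hoeffdingResidual μ h) := by
  have hslice : ∀ᵐ x ∂μ, Integrable (fun y : Fin m → E => h (Fin.cons x y))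
      (Measure.pi fun _ => μ) :=
    ((measurePreserving_fin_cons μ).integrable_comp_of_integrable hint).prod_right_ae
  have hproj : Integrable (hoeffdingProjection μ h) μ := memLp_one_iff_integrable.mp
    (memLp_hoeffdingProjection le_rfl hh (memLp_one_iff_integrable.mpr hint))
  intro j
  filter_upwards [hslice] with x hx
  set θ := ∫ w, h w ∂(Measure.pi fun _ => μ)
  have hcentred (i : Fin m) : Integrable (fun y : Fin m → E => hoeffdingProjection μ h (y i) - θ)
      (Measure.pi fun _ => μ) :=
    (measurePreserving_eval (fun _ : Fin m => μ) i).integrable_comp_of_integrable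
      (hproj.sub (integrable_const θ))
  have hmean (i : Fin m) :
      ∫ y : Fin m → E, (hoeffdingProjection μ h (y i) - θ) ∂(Measure.pi fun _ => μ) = 0 := by
    rw [integral_comp_eval (μ := fun _ => μ) (f := fun z => hoeffdingProjection μ h z - θ)
      (hproj.sub (integrable_const θ)).aestronglyMeasurable,
      integral_sub hproj (integrable_const θ), integral_hoeffdingProjection hh hint]
    simp [θ]
  have hres (y : Fin m → E) : hoeffdingResidual μ h (j.insertNth x y)
      = h (Fin.cons x y) - hoeffdingProjection μ h x
        - ∑ i, (hoeffdingProjection μ h (y i) - θ) := by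
    rw [hoeffdingResidual, Fin.sum_univ_succAbove _ j, hsymm.apply_insertNth]
    simp only [Fin.insertNth_apply_same, Fin.insertNth_apply_succAbove]
    ring
  have hxc : Integrable (fun y : Fin m → E => h (Fin.cons x y) - hoeffdingProjection μ h x)
      (Measure.pi fun _ => μ) := hx.sub (integrable_const _)
  simp_rw [hres]
  rw [integral_sub hxc (integrable_finsetSum _ fun i _ => hcentred i),
    integral_sub hx (integrable_const _), integral_finsetSum _ fun i _ => hcentred i,
    Finset.sum_eq_zero fun i _ => hmean i]
  simp [hoeffdingProjection]

lemma memLp_hoeffdingResidual [IsProbabilityMeasure μ] {p : ℝ≥0∞} (hp : 1 ≤ p)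
    (hh : Measurable h) (hhp : MemLp h p (Measure.pi fun _ => μ)) :
    MemLp (hoeffdingResidual μ h) p (Measure.pi fun _ => μ) := by
  have hproj := (memLp_hoeffdingProjection hp hh hhp).sub
    (memLp_const (∫ w, h w ∂(Measure.pi fun _ => μ)))
  exact (hhp.sub (memLp_const _)).sub <| memLp_finsetSum _ fun i _ =>
    hproj.comp_measurePreserving (measurePreserving_eval (fun _ => μ) i)

end Hoeffding

section Sample

variable {Ω E ι : Type*} [MeasurableSpace Ω] [MeasurableSpace E] {P : Measure Ω}
  [IsProbabilityMeasure P] {μ : Measure E} {X : ι → Ω → E} {k m n : ℕ}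

lemma measurePreserving_subsample {s : Fin k → ι} (hmeas : ∀ i, Measurable (X i))
    (hlaw : ∀ i, P.map (X i) = μ) (hindep : iIndepFun X P) (hs : s.Injective) :
    MeasurePreserving (fun ω i => X (s i) ω) P (Measure.pi fun _ => μ) := by
  refine ⟨by fun_prop, ?_⟩
  simpa [hlaw] using (iIndepFun_iff_map_fun_eq_pi_map
    fun i => (hmeas (s i)).aemeasurable).mp (hindep.precomp hs)

omit [IsProbabilityMeasure P] in
lemma indepFun_subsample {s : Fin k → ι} {t : Fin m → ι} (hmeas : ∀ i, Measurable (X i))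
    (hindep : iIndepFun X P) (hst : ∀ i j, s i ≠ t j) :
    IndepFun (fun ω i => X (s i) ω) (fun ω j => X (t j) ω) P := by
  classical
  have hdisj : Disjoint (Finset.univ.image s) (Finset.univ.image t) := by
    simp only [Finset.disjoint_left, Finset.mem_image, Finset.mem_univ, true_and]
    rintro _ ⟨i, rfl⟩ ⟨j, hj⟩
    exact hst i j hj.symm
  exact (hindep.indepFun_finset _ _ hdisj hmeas).comp
    (φ := fun (u : Finset.univ.image s → E) i => u ⟨s i, by simp⟩)
    (ψ := fun (u : Finset.univ.image t → E) j => u ⟨t j, by simp⟩) (by fun_prop) (by fun_prop)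

lemma integral_mul_eq_zero_of_isDegenerate {f : (Fin k → E) → ℝ} {g : (Fin (m + 1) → E) → ℝ}
    {s : Fin k → ι} {t : Fin (m + 1) → ι} (hmeas : ∀ i, Measurable (X i))
    (hlaw : ∀ i, P.map (X i) = μ) (hindep : iIndepFun X P) (hf : Measurable f)
    (hg : Measurable g) (hdeg : IsDegenerate μ g) (ht : t.Injective) (j₀ : Fin (m + 1))
    (hst : ∀ i, ∀ j ≠ j₀, s i ≠ t j)
    (hint : Integrable (fun ω => f (fun i => X (s i) ω) * g (fun j => X (t j) ω)) P) :
    ∫ ω, f (fun i => X (s i) ω) * g (fun j => X (t j) ω) ∂P = 0 := by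
  have hindep' : IndepFun (fun ω => (fun i => X (s i) ω, X (t j₀) ω))
      (fun ω j => X (t (j₀.succAbove j)) ω) P :=
    (indepFun_subsample (s := Fin.cons (t j₀) s) (t := t ∘ j₀.succAbove) hmeas hindep
      (Fin.cases (fun j => ht.ne (j₀.succAbove_ne j).symm)
        fun i j => hst i _ (j₀.succAbove_ne j))).comp
      (φ := fun v : Fin (k + 1) → E => (fun i : Fin k => v i.succ, v 0)) (ψ := id)
      (by fun_prop) measurable_id
  have hinsert (ω : Ω) : (fun j => X (t j) ω)
      = j₀.insertNth (X (t j₀) ω) fun j => X (t (j₀.succAbove j)) ω :=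
    (Fin.insertNth_self_removeNth j₀ fun j => X (t j) ω).symm
  have hrest := (measurePreserving_subsample hmeas hlaw hindep
    (ht.comp j₀.succAbove_right_injective)).map_eq
  simp_rw [hinsert] at hint ⊢
  refine integral_mul_eq_zero_of_indepFun (g := fun p => g (j₀.insertNth p.1 p.2))
    (by fun_prop) (hmeas _) (by fun_prop) hindep' hf
    (hg.comp (MeasurableEquiv.piFinSuccAbove (fun _ => E) j₀).symm.measurable) hint ?_
  rw [hlaw]
  simpa [Function.comp_def] using hrest ▸ hdeg j₀

end Sample

section SecondMoment

variable {Ω E : Type*} [MeasurableSpace Ω] [MeasurableSpace E] {P : Measure Ω}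
  [IsProbabilityMeasure P] {μ : Measure E} {m n : ℕ}

section FiniteSample

variable {X : Fin n → Ω → E} {g : (Fin (m + 1) → E) → ℝ}

lemma memLp_comp_subsample {p : ℝ≥0∞} (hmeas : ∀ i, Measurable (X i))
    (hlaw : ∀ i, P.map (X i) = μ) (hindep : iIndepFun X P)
    (hgp : MemLp g p (Measure.pi fun _ => μ)) (s : Fin (m + 1) ↪o Fin n) :
    MemLp (fun ω => g ((X · ω) ∘ s)) p P :=
  hgp.comp_measurePreserving (measurePreserving_subsample hmeas hlaw hindep s.injective)

lemma memLp_uStatistic {p : ℝ≥0∞} (hmeas : ∀ i, Measurable (X i))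
    (hlaw : ∀ i, P.map (X i) = μ) (hindep : iIndepFun X P)
    (hgp : MemLp g p (Measure.pi fun _ => μ)) : MemLp (fun ω => uStatistic g (X · ω)) p P :=
  (memLp_finsetSum _ fun s _ => memLp_comp_subsample hmeas hlaw hindep hgp s).const_mul _

lemma integral_mul_le_of_isDegenerate (hmeas : ∀ i, Measurable (X i))
    (hlaw : ∀ i, P.map (X i) = μ) (hindep : iIndepFun X P) (hg : Measurable g)
    (hg2 : MemLp g 2 (Measure.pi fun _ => μ)) (hdeg : IsDegenerate μ g)
    (s t : Fin (m + 1) ↪o Fin n) :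
    ∫ ω, g ((X · ω) ∘ s) * g ((X · ω) ∘ t) ∂P
      ≤ if 2 ≤ (Finset.univ.map s.toEmbedding ∩ Finset.univ.map t.toEmbedding).card
        then ∫ v, g v ^ 2 ∂(Measure.pi fun _ => μ) else 0 := by
  have hmem := memLp_comp_subsample hmeas hlaw hindep hg2
  have hsq (s : Fin (m + 1) ↪o Fin n) :
      ∫ ω, g ((X · ω) ∘ s) ^ 2 ∂P = ∫ v, g v ^ 2 ∂(Measure.pi fun _ => μ) := by
    have hmp := measurePreserving_subsample hmeas hlaw hindep s.injective
    rw [← hmp.map_eq, integral_map hmp.aemeasurable (hg.pow_const 2).aestronglyMeasurable]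
    rfl
  split_ifs with hcard
  · calc ∫ ω, g ((X · ω) ∘ s) * g ((X · ω) ∘ t) ∂P
        ≤ ∫ ω, (g ((X · ω) ∘ s) ^ 2 + g ((X · ω) ∘ t) ^ 2) / 2 ∂P :=
          integral_mono ((hmem s).integrable_mul (hmem t))
            (((hmem s).integrable_sq.add (hmem t).integrable_sq).div_const 2)
            fun ω => by nlinarith only [sq_nonneg (g ((X · ω) ∘ s) - g ((X · ω) ∘ t))]
      _ = ∫ v, g v ^ 2 ∂(Measure.pi fun _ => μ) := by
          rw [integral_div, integral_add (hmem s).integrable_sq (hmem t).integrable_sq,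
            hsq, hsq, add_self_div_two]
  · obtain ⟨j₀, hj₀⟩ : ∃ j₀, ∀ i, ∀ j ≠ j₀, s i ≠ t j :=
      exists_forall_ne_of_card_inter_lt_two (not_le.mp hcard)
    exact (integral_mul_eq_zero_of_isDegenerate hmeas hlaw hindep hg hg hdeg t.injective j₀ hj₀
      ((hmem s).integrable_mul (hmem t))).le

lemma integral_sq_sum_le_of_isDegenerate (hmeas : ∀ i, Measurable (X i))
    (hlaw : ∀ i, P.map (X i) = μ) (hindep : iIndepFun X P) (hg : Measurable g)
    (hg2 : MemLp g 2 (Measure.pi fun _ => μ)) (hdeg : IsDegenerate μ g) :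
    ∫ ω, (∑ s : Fin (m + 1) ↪o Fin n, g ((X · ω) ∘ s)) ^ 2 ∂P
      ≤ n.choose (m + 1) * ((m + 1).choose 2 * (n - 2).choose (m - 1))
        * ∫ v, g v ^ 2 ∂(Measure.pi fun _ => μ) := by
  have hmem := memLp_comp_subsample hmeas hlaw hindep hg2
  have hmul (s t : Fin (m + 1) ↪o Fin n) :
      Integrable (fun ω => g ((X · ω) ∘ s) * g ((X · ω) ∘ t)) P :=
    (hmem s).integrable_mul (hmem t)
  simp_rw [sq (Finset.sum _ _), Finset.sum_mul_sum]
  rw [integral_finsetSum _ fun s _ => integrable_finsetSum _ fun t _ => hmul s t]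
  set A := ∫ v, g v ^ 2 ∂(Measure.pi fun _ => μ)
  have hA : 0 ≤ A := integral_nonneg fun v => sq_nonneg (g v)
  have hrow (s : Fin (m + 1) ↪o Fin n) :
      ∫ ω, ∑ t : Fin (m + 1) ↪o Fin n, g ((X · ω) ∘ s) * g ((X · ω) ∘ t) ∂P
        ≤ (m + 1).choose 2 * (n - 2).choose (m - 1) * A := by
    rw [integral_finsetSum _ fun t _ => hmul s t]
    refine (Finset.sum_le_sum fun t _ =>
      integral_mul_le_of_isDegenerate hmeas hlaw hindep hg hg2 hdeg s t).trans ?_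
    rw [← Finset.sum_filter, Finset.sum_const, nsmul_eq_mul]
    exact mul_le_mul_of_nonneg_right (mod_cast card_filter_two_le_card_inter_le s) hA
  refine (Finset.sum_le_sum fun s _ => hrow s).trans_eq ?_
  rw [Finset.sum_const, Finset.card_univ, card_orderEmbedding_fin, nsmul_eq_mul]
  ring

lemma choose_two_mul_integral_sq_uStatistic_le (hmeas : ∀ i, Measurable (X i))
    (hlaw : ∀ i, P.map (X i) = μ) (hindep : iIndepFun X P) (hg : Measurable g)
    (hg2 : MemLp g 2 (Measure.pi fun _ => μ)) (hdeg : IsDegenerate μ g) :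
    n.choose 2 * ∫ ω, uStatistic g (X · ω) ^ 2 ∂P
      ≤ (m + 1).choose 2 ^ 2 * ∫ v, g v ^ 2 ∂(Measure.pi fun _ => μ) := by
  have hchoose : (n.choose 2 : ℝ) * ((m + 1).choose 2 * (n - 2).choose (m - 1))
      = n.choose (m + 1) * (m + 1).choose 2 ^ 2 := by
    rcases Nat.eq_zero_or_pos m with rfl | hm
    · simp
    · have := Nat.choose_mul (n := n) (k := m + 1) (s := 2) (by omega)
      norm_cast
      rw [mul_left_comm, show m - 1 = m + 1 - 2 by omega, ← this]
      ring
  set A := ∫ v, g v ^ 2 ∂(Measure.pi fun _ => μ)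
  have : 0 ≤ A := integral_nonneg fun v => sq_nonneg (g v)
  have hsum := integral_sq_sum_le_of_isDegenerate hmeas hlaw hindep hg hg2 hdeg
  simp_rw [uStatistic, mul_pow, integral_const_mul]
  rcases Nat.eq_zero_or_pos (n.choose (m + 1)) with hn | hn
  · suffices 0 ≤ ((m + 1).choose 2 : ℝ) ^ 2 * A by simpa [hn]
    positivity
  · have : (0 : ℝ) < n.choose (m + 1) := by exact_mod_cast hn
    calc _ ≤ (n.choose 2 : ℝ) * ((n.choose (m + 1) : ℝ)⁻¹ ^ 2 * (n.choose (m + 1)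
            * ((m + 1).choose 2 * (n - 2).choose (m - 1)) * A)) := by gcongr
      _ = (m + 1).choose 2 ^ 2 * A := by
          field_simp
          linear_combination A * hchoose

end FiniteSample

omit [IsProbabilityMeasure P] in
lemma tendstoInMeasure_zero_of_tendsto_integral_sq {ι : Type*} {l : Filter ι} {f : ι → Ω → ℝ}
    [IsFiniteMeasure P] (hf : ∀ i, MemLp (f i) 2 P)
    (hlim : Tendsto (fun i => ∫ ω, f i ω ^ 2 ∂P) l (nhds 0)) :
    TendstoInMeasure P f l (fun _ => (0 : ℝ)) := by
  rw [tendstoInMeasure_iff_measureReal_norm]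
  intro ε hε
  refine squeeze_zero (fun i => measureReal_nonneg) (fun i => ?_)
    (by simpa using hlim.const_mul (ε ^ 2)⁻¹)
  have hset : {ω | ε ≤ ‖f i ω - 0‖} = {ω | ε ^ 2 ≤ f i ω ^ 2} := by
    ext ω
    simp [sq_le_sq, abs_of_pos hε]
  rw [hset, le_inv_mul_iff₀ (by positivity)]
  exact mul_meas_ge_le_integral_of_nonneg (ae_of_all _ fun ω => sq_nonneg (f i ω))
    (hf i).integrable_sq (ε ^ 2)

lemma uStatistic_hoeffdingResidual {h : (Fin (m + 1) → E) → ℝ} (hmn : m + 1 ≤ n)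
    (x : Fin n → E) :
    uStatistic (hoeffdingResidual μ h) x = uStatistic h x - ∫ v, h v ∂(Measure.pi fun _ => μ)
      - (m + 1) / n * ∑ i, (hoeffdingProjection μ h (x i) - ∫ v, h v ∂(Measure.pi fun _ => μ)) := by
  rw [← uStatistic_sum hmn
      fun a => hoeffdingProjection μ h a - ∫ v, h v ∂(Measure.pi fun _ => μ),
    ← uStatistic_const hmn (∫ v, h v ∂(Measure.pi fun _ => μ)) x, ← uStatistic_sub,
    ← uStatistic_sub]
  simp only [uStatistic_const hmn]
  rfl

variable {X : ℕ → Ω → E} {h g : (Fin (m + 1) → E) → ℝ}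

lemma tendstoInMeasure_sqrt_mul_uStatistic_of_isDegenerate (hmeas : ∀ i, Measurable (X i))
    (hlaw : ∀ i, P.map (X i) = μ) (hindep : iIndepFun X P) (hg : Measurable g)
    (hg2 : MemLp g 2 (Measure.pi fun _ => μ)) (hdeg : IsDegenerate μ g) :
    TendstoInMeasure P (fun (n : ℕ) ω => √(n : ℝ) * uStatistic g (fun i : Fin n => X i ω))
      atTop (fun _ => (0 : ℝ)) := by
  have hsample (n : ℕ) : iIndepFun (fun i : Fin n => X i) P := hindep.precomp Fin.val_injective
  have hbound (n : ℕ) := choose_two_mul_integral_sq_uStatistic_le (fun i => hmeas i)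
    (fun i => hlaw i) (hsample n) hg hg2 hdeg
  set B := ((m + 1).choose 2 : ℝ) ^ 2 * ∫ v, g v ^ 2 ∂(Measure.pi fun _ => μ)
  have hrate : Tendsto (fun n : ℕ => 2 * B / ((n - 1 : ℕ) : ℝ)) atTop (nhds 0) :=
    (tendsto_natCast_atTop_atTop.comp (tendsto_sub_atTop_nat 1)).const_div_atTop _
  refine tendstoInMeasure_zero_of_tendsto_integral_sq (fun n =>
    (memLp_uStatistic (fun i => hmeas i) (fun i => hlaw i) (hsample n) hg2).const_mul _)
    (squeeze_zero' (Eventually.of_forall fun n => integral_nonneg fun ω => sq_nonneg _) ?_ hrate)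
  filter_upwards [eventually_ge_atTop 2] with n hn
  have hpos : (0 : ℝ) < (n - 1 : ℕ) := by exact_mod_cast Nat.sub_pos_of_lt hn
  have hchoose : (n : ℝ) * (n - 1 : ℕ) = 2 * n.choose 2 := by
    rw [Nat.cast_choose_two, Nat.cast_pred (by omega)]
    ring
  simp_rw [mul_pow, Real.sq_sqrt (Nat.cast_nonneg n), integral_const_mul]
  rw [le_div_iff₀ hpos]
  linear_combination 2 * hbound n + (∫ ω, uStatistic g (fun i : Fin n => X i ω) ^ 2 ∂P) * hchoose

lemma sqrt_mul_uStatistic_sub_eq (hmn : m + 1 ≤ n) (x : Fin n → E) :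
    √(n : ℝ) * (uStatistic h x - ∫ v, h v ∂(Measure.pi fun _ => μ))
      = (√(n : ℝ))⁻¹ * (∑ i, (m + 1) * hoeffdingProjection μ h (x i)
          - n * ((m + 1) * ∫ v, h v ∂(Measure.pi fun _ => μ)))
        + √(n : ℝ) * uStatistic (hoeffdingResidual μ h) x := by
  rw [uStatistic_hoeffdingResidual hmn, ← Real.sqrt_div_self, Finset.sum_sub_distrib,
    Finset.sum_const, Finset.card_univ, Fintype.card_fin, nsmul_eq_mul, ← Finset.mul_sum]
  ring

theorem tendstoInDistribution_sqrt_mul_uStatistic_sub {Ω' : Type*} [MeasurableSpace Ω']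
    {P' : Measure Ω'} [IsProbabilityMeasure P'] {Y : Ω' → ℝ} (hmeas : ∀ i, Measurable (X i))
    (hlaw : ∀ i, P.map (X i) = μ) (hindep : iIndepFun X P) (hh : Measurable h)
    (hh2 : MemLp h 2 (Measure.pi fun _ => μ)) (hsymm : IsSymmetric h)
    (hY : HasLaw Y
      (gaussianReal 0 ((m + 1) ^ 2 * Var[hoeffdingProjection μ h; μ]).toNNReal) P') :
    TendstoInDistribution (fun (n : ℕ) ω => √(n : ℝ) * (uStatistic h (fun i : Fin n => X i ω)
      - ∫ v, h v ∂(Measure.pi fun _ => μ))) atTop Y (fun _ => P) P' := by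
  have : IsProbabilityMeasure μ := hlaw 0 ▸ Measure.isProbabilityMeasure_map (hmeas 0).aemeasurable
  have hint := hh2.integrable one_le_two
  have hproj := measurable_hoeffdingProjection (μ := μ) hh
  have hmean : ∫ ω, (m + 1) * hoeffdingProjection μ h (X 0 ω) ∂P
      = (m + 1) * ∫ v, h v ∂(Measure.pi fun _ => μ) := by
    have := integral_map (hmeas 0).aemeasurable (hproj.aestronglyMeasurable (μ := P.map (X 0)))
    rw [integral_const_mul, ← this, hlaw 0, integral_hoeffdingProjection hh hint]
  have hvar : Var[fun ω => (m + 1) * hoeffdingProjection μ h (X 0 ω); P]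
      = (m + 1) ^ 2 * Var[hoeffdingProjection μ h; μ] := by
    have := variance_map (hproj.aemeasurable (μ := P.map (X 0))) (hmeas 0).aemeasurable
    rw [hlaw 0] at this
    rw [variance_const_mul, this]
    rfl
  have hclt := tendstoInDistribution_inv_sqrt_mul_sum_sub
    (X := fun i ω => (m + 1) * hoeffdingProjection μ h (X i ω)) (P := P) (Y := Y) (P' := P')
    (hvar ▸ hY)
    (((memLp_hoeffdingProjection one_le_two hh hh2).comp_measurePreserving
      ⟨hmeas 0, hlaw 0⟩).const_mul _)
    (hindep.comp (fun _ z => (m + 1) * hoeffdingProjection μ h z) fun _ => hproj.const_mul _)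
    fun i => (IdentDistrib.mk (hmeas i).aemeasurable (hmeas 0).aemeasurable
      ((hlaw i).trans (hlaw 0).symm)).comp (hproj.const_mul _)
  refine tendstoInDistribution_of_tendstoInMeasure_sub _ _ hclt ?_ fun n =>
    (((measurable_uStatistic hh).comp (by fun_prop)).sub_const _).const_mul _ |>.aemeasurable
  refine (tendstoInMeasure_sqrt_mul_uStatistic_of_isDegenerate hmeas hlaw hindep
    (measurable_hoeffdingResidual hh) (memLp_hoeffdingResidual one_le_two hh hh2)
    (isDegenerate_hoeffdingResidual hh hint hsymm)).congr' ?_ EventuallyEq.rfl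
  filter_upwards [eventually_ge_atTop (m + 1)] with n hn
  refine ae_of_all _ fun ω => ?_
  simp only [Pi.sub_apply, hmean, sqrt_mul_uStatistic_sub_eq (μ := μ) hn, Finset.sum_range]
  ring

end SecondMoment

section FinSums

lemma sum_sum_eq_sum_sum_Ioi_add {ι M : Type*} [Fintype ι] [LinearOrder ι]
    [LocallyFiniteOrderTop ι] [LocallyFiniteOrderBot ι] [AddCommMonoid M] (f : ι → ι → M) :
    ∑ i, ∑ j, f i j = ∑ i, ∑ j ∈ Finset.Ioi i, (f i j + f j i) + ∑ i, f i i := by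
  rw [Finset.sum_sum_Ioi_add_eq_sum_sum_off_diag fun i j => f j i, ← Finset.sum_add_distrib]
  exact Finset.sum_congr rfl fun i _ => (Finset.sum_compl_add_sum {i} (f i)).symm.trans <| by
    rw [Finset.sum_singleton]

lemma sum_card_Ioi (n : ℕ) : ∑ i : Fin n, ((Finset.Ioi i).card : ℝ) = n.choose 2 := by
  have h := sum_sum_eq_sum_sum_Ioi_add (ι := Fin n) fun _ _ => (1 : ℝ)
  simp only [Finset.sum_add_distrib, Finset.sum_const, Finset.card_univ, Fintype.card_fin,
    nsmul_eq_mul, mul_one] at h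
  rw [Nat.cast_choose_two]
  linarith

lemma sum_sum_sum_Ioi {M : Type*} [AddCommMonoid M] {n : ℕ} (f : Fin n → Fin n → Fin n → M) :
    ∑ k, ∑ i, ∑ j ∈ Finset.Ioi i, f i j k
      = ∑ i, ∑ j ∈ Finset.Ioi i, ∑ k ∈ Finset.Ioi j, (f i j k + f i k j + f j k i)
        + ∑ i, ∑ j ∈ Finset.Ioi i, (f i j i + f i j j) := by
  induction n with
  | zero => simp
  | succ n ih =>
    have hpairs := sum_sum_eq_sum_sum_Ioi_add fun j k : Fin n => f 0 j.succ k.succ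
    rw [Finset.sum_comm] at hpairs
    simp only [Fin.sum_univ_succ, Fin.sum_Ioi_zero, Fin.sum_Ioi_succ,
      Finset.sum_add_distrib] at hpairs ⊢
    have ih' := ih fun i j k => f i.succ j.succ k.succ
    simp only [Finset.sum_add_distrib] at ih'
    rw [hpairs, ih']
    abel

lemma sum_orderEmbedding_three {M : Type*} [AddCommMonoid M] {n : ℕ}
    (f : Fin n → Fin n → Fin n → M) :
    ∑ s : Fin 3 ↪o Fin n, f (s 0) (s 1) (s 2)
      = ∑ i, ∑ j ∈ Finset.Ioi i, ∑ k ∈ Finset.Ioi j, f i j k := by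
  simp_rw [Finset.sum_sigma']
  refine Finset.sum_bij' (fun s _ => ⟨s 0, s 1, s 2⟩)
    (fun t ht => OrderEmbedding.ofStrictMono ![t.1, t.2.1, t.2.2] ?_) ?_ ?_ ?_ ?_ ?_
  · simpa [Fin.strictMono_iff_lt_succ, Fin.forall_fin_two] using ht
  · simp
  · simp
  · intro s _
    ext i
    fin_cases i <;> rfl
  · intro t _
    rfl
  · simp

end FinSums
section TestStatistic

variable {n : ℕ} {x : Fin n → ℝ}

lemma ratioInd_comm (x y z : ℝ) : ratioInd x y z = ratioInd y x z := by
  simp only [ratioInd, max_comm]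

lemma ratioInd_mem_Icc (x y z : ℝ) : ratioInd x y z ∈ Set.Icc 0 1 := by
  unfold ratioInd
  split_ifs <;> simp

lemma abs_kernel_le (x y z : ℝ) : |kernel x y z| ≤ 1 / 2 := by
  have hz := ratioInd_mem_Icc x y z
  have hy := ratioInd_mem_Icc x z y
  have hx := ratioInd_mem_Icc y z x
  rw [Set.mem_Icc] at hx hy hz
  rw [kernel, abs_le]
  constructor <;> linarith

@[fun_prop]
lemma measurable_ratioInd {β : Type*} [MeasurableSpace β] {f g h : β → ℝ} (hf : Measurable f)
    (hg : Measurable g) (hh : Measurable h) :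
    Measurable fun b => ratioInd (f b) (g b) (h b) :=
  Measurable.ite (measurableSet_le ((hf.div hg).max (hg.div hf)) hh) measurable_const
    measurable_const

/-- The kernel of degree three as a function of the vector of its arguments, the form in which
kernels enter `uStatistic`. -/
noncomputable def vecKernel (v : Fin 3 → ℝ) : ℝ := kernel (v 0) (v 1) (v 2)

lemma measurable_vecKernel : Measurable vecKernel := by
  unfold vecKernel kernel
  fun_prop

lemma kernel_swap_left (x y z : ℝ) : kernel y x z = kernel x y z := by
  rw [kernel, kernel, ratioInd_comm y x]
  ring

lemma kernel_swap_right (x y z : ℝ) : kernel x z y = kernel x y z := by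
  rw [kernel, kernel, ratioInd_comm z y]
  ring

lemma isSymmetric_vecKernel : IsSymmetric vecKernel := by
  intro v σ
  have hσ : σ ∈ Submonoid.closure
      (Set.range fun i : Fin 2 => Equiv.swap i.castSucc i.succ) :=
    Equiv.Perm.mclosure_swap_castSucc_succ 2 ▸ Submonoid.mem_top σ
  induction hσ using Submonoid.closure_induction generalizing v with
  | mem _ h =>
    obtain ⟨i, rfl⟩ := h
    fin_cases i
    · exact kernel_swap_left _ _ _
    · exact kernel_swap_right _ _ _
  | one => rfl
  | mul σ τ _ _ ihσ ihτ => exact (ihτ (v ∘ σ)).trans (ihσ v)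

lemma uStat_eq_uStatistic (x : Fin n → ℝ) : uStat x = uStatistic vecKernel x := by
  rw [uStat, uStatistic, ← sum_orderEmbedding_three fun i j k => kernel (x i) (x j) (x k)]
  rfl

lemma abs_uStat_le (hn : 3 ≤ n) (x : Fin n → ℝ) : |uStat x| ≤ 1 / 2 := by
  have hpos : (0 : ℝ) < n.choose 3 := by exact_mod_cast Nat.choose_pos hn
  rw [uStat_eq_uStatistic, uStatistic, abs_mul, abs_inv, Nat.abs_cast, inv_mul_le_iff₀ hpos]
  refine (Finset.abs_sum_le_sum_abs _ _).trans
    ((Finset.sum_le_card_nsmul _ _ _ fun s _ => abs_kernel_le _ _ _).trans_eq ?_)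
  rw [Finset.card_univ, card_orderEmbedding_fin, nsmul_eq_mul]

lemma integral_empMeasure (x : Fin n → ℝ) (f : ℝ → ℝ) :
    ∫ t, f t ∂(empMeasure x) = (n : ℝ)⁻¹ * ∑ i, f (x i) := by
  rw [empMeasure, integral_smul_measure,
    integral_finsetSum_measure fun i _ => integrable_dirac enorm_lt_top]
  simp

lemma testStat_eq (x : Fin n → ℝ) :
    testStat x = (n : ℝ)⁻¹ *
      ∑ k, if 1 ≤ x k then ratioEmpCDF x (x k) - empCDF x (x k) else 0 := by
  rw [testStat, ← integral_indicator measurableSet_Ici, integral_empMeasure]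
  simp only [Set.indicator_apply, Set.mem_Ici]

lemma measurable_testStat : Measurable (testStat : (Fin n → ℝ) → ℝ) := by
  have hemp (k : Fin n) : Measurable fun x : Fin n → ℝ => empCDF x (x k) :=
    (Finset.measurable_sum _ fun i _ => Measurable.ite (measurableSet_le (by fun_prop)
      (by fun_prop)) measurable_const measurable_const).const_mul _
  have hratio (k : Fin n) : Measurable fun x : Fin n → ℝ => ratioEmpCDF x (x k) := by
    unfold ratioEmpCDF
    fun_prop
  simp_rw [funext testStat_eq]
  exact (Finset.measurable_sum _ fun k _ => Measurable.ite (measurableSet_le (by fun_prop)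
    (by fun_prop)) ((hratio k).sub (hemp k)) measurable_const).const_mul _

lemma sum_empCDF_of_injective (hn : n ≠ 0) (hx : x.Injective) :
    ∑ k, empCDF x (x k) = (n + 1) / 2 := by
  have hpair (i j : Fin n) (hj : j ∈ Finset.Ioi i) :
      ((if x j ≤ x i then 1 else 0) + if x i ≤ x j then 1 else 0 : ℝ) = 1 := by
    rcases (hx.ne (Finset.mem_Ioi.mp hj).ne).lt_or_gt with h | h
    · simp [h.le, h.not_ge]
    · simp [h.le, h.not_ge]
  have : (n : ℝ) ≠ 0 := Nat.cast_ne_zero.mpr hn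
  simp only [empCDF]
  rw [← Finset.mul_sum, sum_sum_eq_sum_sum_Ioi_add,
    Finset.sum_congr rfl fun i _ => Finset.sum_congr rfl (hpair i)]
  simp only [Finset.sum_const, nsmul_eq_mul, mul_one, sum_card_Ioi, le_refl, if_true,
    Finset.card_univ, Fintype.card_fin, Nat.cast_choose_two]
  field_simp
  ring

lemma sum_ratioEmpCDF (hn : 3 ≤ n) (x : Fin n → ℝ) :
    ∑ k, ratioEmpCDF x (x k) = (n - 2) * (uStat x + 1 / 2)
      + (n.choose 2 : ℝ)⁻¹ * ∑ i, ∑ j ∈ Finset.Ioi i,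
        (ratioInd (x i) (x j) (x i) + ratioInd (x i) (x j) (x j)) := by
  have hpos₂ : (n.choose 2 : ℝ) ≠ 0 := by exact_mod_cast (Nat.choose_pos (by omega)).ne'
  have hpos₃ : (n.choose 3 : ℝ) ≠ 0 := by exact_mod_cast (Nat.choose_pos hn).ne'
  have hchoose : (n.choose 3 : ℝ) * 3 = n.choose 2 * (n - 2) := by
    have := Nat.choose_succ_right_eq n 2
    have hcast : ((n - 2 : ℕ) : ℝ) = n - 2 := by rw [Nat.cast_sub (by omega), Nat.cast_ofNat]
    rw [← hcast]
    exact_mod_cast this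
  have hkernel (i j k : Fin n) : ratioInd (x i) (x j) (x k) + ratioInd (x i) (x k) (x j)
      + ratioInd (x j) (x k) (x i) = 3 * (kernel (x i) (x j) (x k) + 1 / 2) := by
    rw [kernel]
    ring
  have htriples : ∑ i, ∑ j ∈ Finset.Ioi i, ∑ k ∈ Finset.Ioi j,
      3 * (kernel (x i) (x j) (x k) + 1 / 2) = n.choose 3 * 3 * (uStat x + 1 / 2) := by
    rw [← sum_orderEmbedding_three fun i j k => 3 * (kernel (x i) (x j) (x k) + 1 / 2),
      ← Finset.mul_sum, Finset.sum_add_distrib, Finset.sum_const, Finset.card_univ,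
      card_orderEmbedding_fin, nsmul_eq_mul, uStat_eq_uStatistic, uStatistic]
    simp only [vecKernel, Function.comp_apply]
    field_simp
  simp only [ratioEmpCDF]
  rw [← Finset.mul_sum, sum_sum_sum_Ioi]
  simp only [hkernel]
  rw [htriples, hchoose]
  field_simp

lemma abs_testStat_sub_uStat_le (hn : 3 ≤ n) (hx : ∀ i, 1 ≤ x i) (hinj : x.Injective) :
    |testStat x - uStat x| ≤ 3 / n := by
  have hpos₂ : (0 : ℝ) < n.choose 2 := by exact_mod_cast Nat.choose_pos (by omega)
  have hstat := sum_ratioEmpCDF hn x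
  set d := (n.choose 2 : ℝ)⁻¹ * ∑ i, ∑ j ∈ Finset.Ioi i,
    (ratioInd (x i) (x j) (x i) + ratioInd (x i) (x j) (x j))
  have hd : 0 ≤ d := mul_nonneg (by positivity) <| Finset.sum_nonneg fun i _ =>
    Finset.sum_nonneg fun j _ => add_nonneg (ratioInd_mem_Icc _ _ _).1 (ratioInd_mem_Icc _ _ _).1
  have hd' : d ≤ 2 := by
    rw [inv_mul_le_iff₀ hpos₂, ← sum_card_Ioi, Finset.sum_mul]
    refine Finset.sum_le_sum fun i _ => ?_
    rw [← nsmul_eq_mul]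
    refine Finset.sum_le_card_nsmul _ _ _ fun j _ => ?_
    linarith [(ratioInd_mem_Icc (x i) (x j) (x i)).2, (ratioInd_mem_Icc (x i) (x j) (x j)).2]
  have hdiff : testStat x - uStat x = (d - 2 * uStat x - 3 / 2) / n := by
    simp only [testStat_eq, hx, if_true]
    rw [Finset.sum_sub_distrib, hstat, sum_empCDF_of_injective (by omega) hinj]
    field_simp
    ring
  have hU := abs_le.mp (abs_uStat_le hn x)
  rw [hdiff, abs_div, Nat.abs_cast]
  gcongr
  rw [abs_le]
  constructor <;> linarith

end TestStatistic

section Equivalence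

variable {Ω E ι : Type*} [MeasurableSpace Ω] [MeasurableSpace E] {P : Measure Ω}

lemma tendstoInMeasure_zero_of_ae_abs_le [IsFiniteMeasure P] {l : Filter ι} {f : ι → Ω → ℝ}
    {u : ι → ℝ} (hu : Tendsto u l (nhds 0)) (hle : ∀ᶠ i in l, ∀ᵐ ω ∂P, |f i ω| ≤ u i) :
    TendstoInMeasure P f l (fun _ => (0 : ℝ)) := by
  rw [tendstoInMeasure_iff_measureReal_norm]
  intro ε hε
  refine tendsto_const_nhds.congr' ?_
  filter_upwards [hle, hu.eventually_lt_const hε] with i hi hui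
  symm
  rw [measureReal_eq_zero_iff, ← compl_compl {ω | _}]
  filter_upwards [hi] with ω hω
  simpa using hω.trans_lt hui

lemma ae_injective_of_iIndepFun [IsProbabilityMeasure P] [Countable ι] [MeasurableEq E]
    {X : ι → Ω → E} (hmeas : ∀ i, Measurable (X i))
    (hatom : ∀ i, NullSingletonClass (P.map (X i))) (hindep : iIndepFun X P) :
    ∀ᵐ ω ∂P, Function.Injective fun i => X i ω := by
  have hdiag (i j : ι) (hij : i ≠ j) : ∀ᵐ ω ∂P, X i ω ≠ X j ω := by
    have : IsProbabilityMeasure (P.map (X i)) :=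
      Measure.isProbabilityMeasure_map (hmeas i).aemeasurable
    have hprod : ∀ᵐ p ∂((P.map (X i)).prod (P.map (X j))), p.1 ≠ p.2 := by
      refine (Measure.ae_prod_iff_ae_ae (p := fun p => p.1 ≠ p.2)
        (measurableSet_eq_fun measurable_fst measurable_snd).compl).mpr (ae_of_all _ fun x => ?_)
      simp [ae_iff]
    rw [← (hindep.indepFun hij).map_prod_eq_prod_map_map (hmeas i).aemeasurable
      (hmeas j).aemeasurable] at hprod
    exact ae_of_ae_map ((hmeas i).prodMk (hmeas j)).aemeasurable hprod
  have hall : ∀ᵐ ω ∂P, ∀ i j, i ≠ j → X i ω ≠ X j ω := by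
    simpa only [ae_all_iff, Filter.eventually_imp_distrib_left] using hdiag
  filter_upwards [hall] with ω hω i j hij
  exact not_imp_not.mp (hω i j) hij

lemma tendstoInMeasure_sqrt_mul_testStat_sub_uStat [IsProbabilityMeasure P] {X : ℕ → Ω → ℝ}
    (hmeas : ∀ i, Measurable (X i)) (hatom : ∀ i, NullSingletonClass (P.map (X i)))
    (hone : ∀ i, ∀ᵐ ω ∂P, 1 ≤ X i ω) (hindep : iIndepFun X P) :
    TendstoInMeasure P (fun (n : ℕ) ω => √(n : ℝ) * (testStat (fun i : Fin n => X i ω)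
      - uStat (fun i : Fin n => X i ω))) atTop (fun _ => (0 : ℝ)) := by
  have hrate : Tendsto (fun n : ℕ => 3 / √(n : ℝ)) atTop (nhds 0) :=
    (Real.tendsto_sqrt_atTop.comp tendsto_natCast_atTop_atTop).const_div_atTop 3
  refine tendstoInMeasure_zero_of_ae_abs_le hrate ?_
  filter_upwards [eventually_ge_atTop 3] with n hn
  filter_upwards [ae_all_iff.mpr hone, ae_injective_of_iIndepFun hmeas hatom hindep]
    with ω hω hinj
  calc |√(n : ℝ) * (testStat (fun i : Fin n => X i ω) - uStat (fun i : Fin n => X i ω))|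
      ≤ √(n : ℝ) * (3 / n) := by
        rw [abs_mul, abs_of_nonneg (Real.sqrt_nonneg _)]
        gcongr
        exact abs_testStat_sub_uStat_le hn (fun i => hω i) (hinj.comp Fin.val_injective)
    _ = 3 / √(n : ℝ) := by rw [mul_div_left_comm, Real.sqrt_div_self, ← div_eq_mul_inv]

end Equivalence

section Pareto

variable {t r α s : ℝ}

lemma integral_Ioi_one_log_pow_mul_rpow (k : ℕ) {c : ℝ} (hc : 0 < c) :
    ∫ s in Set.Ioi (1 : ℝ), Real.log s ^ k * s ^ (-c - 1) = k.factorial / c ^ (k + 1) := by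
  have hrpow : ∀ s ∈ Set.Ioi (1 : ℝ), Real.log s ^ k * s ^ (-c - 1)
      = s⁻¹ • (Real.log s ^ ((k + 1 : ℝ) - 1) * Real.exp (-(c * Real.log s))) := by
    intro s hs
    have hs₀ : 0 < s := one_pos.trans hs
    rw [add_sub_cancel_right, Real.rpow_natCast, Real.rpow_sub_one hs₀.ne',
      Real.rpow_def_of_pos hs₀, smul_eq_mul, mul_neg, mul_comm (Real.log s) c]
    ring
  rw [setIntegral_congr_fun measurableSet_Ioi hrpow,
    integral_comp_log_Ioi (fun y => y ^ ((k + 1 : ℝ) - 1) * Real.exp (-(c * y))) one_pos,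
    Real.log_one, Real.integral_rpow_mul_exp_neg_mul_Ioi (by positivity) hc,
    Real.Gamma_nat_eq_factorial, ← Nat.cast_add_one, Real.rpow_natCast, one_div, inv_pow,
    mul_comm, div_eq_mul_inv]

lemma integrableOn_Ioi_one_log_pow_mul_rpow (k : ℕ) {c : ℝ} (hc : 0 < c) :
    IntegrableOn (fun s : ℝ => Real.log s ^ k * s ^ (-c - 1)) (Set.Ioi 1) :=
  .of_integral_ne_zero <| by
    rw [integral_Ioi_one_log_pow_mul_rpow k hc]
    positivity

instance nullSingletonClass_paretoMeasure (t r : ℝ) : NullSingletonClass (paretoMeasure t r) :=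
  inferInstanceAs (NullSingletonClass (volume.withDensity (paretoPDF t r)))

lemma ae_le_paretoMeasure (t r : ℝ) : ∀ᵐ x ∂paretoMeasure t r, t ≤ x := by
  simp only [ae_iff, not_le]
  exact (withDensity_apply _ measurableSet_Iio).trans (lintegral_paretoPDF_of_le le_rfl)

lemma integral_paretoMeasure (ht : 0 ≤ t) (hr : 0 ≤ r) (f : ℝ → ℝ) :
    ∫ x, f x ∂paretoMeasure t r = ∫ x in Set.Ioi t, f x * (r * t ^ r * x ^ (-r - 1)) := by
  have hpdf : Measurable (paretoPDF t r) := (measurable_paretoPDFReal t r).ennreal_ofReal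
  rw [paretoMeasure, integral_withDensity_eq_integral_toReal_smul hpdf
    (ae_of_all _ fun x => ENNReal.ofReal_lt_top),
    ← integral_Ici_eq_integral_Ioi, ← integral_indicator measurableSet_Ici]
  congr with x
  rw [paretoPDF, ENNReal.toReal_ofReal (paretoPDFReal_nonneg ht hr x), paretoPDFReal, neg_add',
    Set.indicator_apply, smul_eq_mul, mul_comm]
  simp only [Set.mem_Ici, mul_ite, mul_zero]

lemma integral_paretoMeasure_one (hα : 0 ≤ α) (f : ℝ → ℝ) :
    ∫ x, f x ∂paretoMeasure 1 α = ∫ x in Set.Ioi 1, f x * (α * x ^ (-α - 1)) := by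
  simp only [integral_paretoMeasure zero_le_one hα, Real.one_rpow, mul_one]

lemma integral_rpow_paretoMeasure (ht : 0 < t) (hr : 0 ≤ r) {p : ℝ} (hp : p < r) :
    ∫ x, x ^ p ∂paretoMeasure t r = r * t ^ p / (r - p) := by
  have hrpow : ∀ x ∈ Set.Ioi t, x ^ p * (r * t ^ r * x ^ (-r - 1))
      = r * t ^ r * x ^ (p - r - 1) := by
    intro x hx
    rw [mul_left_comm, ← Real.rpow_add (ht.trans hx)]
    ring_nf
  rw [integral_paretoMeasure ht.le hr, setIntegral_congr_fun measurableSet_Ioi hrpow,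
    integral_const_mul, integral_Ioi_rpow_of_lt (by linarith) ht, sub_add_cancel,
    Real.rpow_sub ht, ← neg_sub r p]
  have := Real.rpow_pos_of_pos ht r
  field_simp [sub_pos.mpr hp]

lemma paretoMeasure_real_Ioi (ht : 0 < t) (hr : 0 < r) {c : ℝ} (hc : t ≤ c) :
    (paretoMeasure t r).real (Set.Ioi c) = (t / c) ^ r := by
  have hc₀ : 0 < c := ht.trans_le hc
  rw [← integral_indicator_one measurableSet_Ioi, integral_paretoMeasure ht.le hr.le]
  have hmul : (fun x => (Set.Ioi c).indicator 1 x * (r * t ^ r * x ^ (-r - 1)))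
      = (Set.Ioi c).indicator fun x => r * t ^ r * x ^ (-r - 1) := by
    ext x
    simp only [Set.indicator_apply, Pi.one_apply, ite_mul, one_mul, zero_mul]
  rw [hmul, setIntegral_indicator measurableSet_Ioi, Set.inter_eq_right.mpr (Set.Ioi_subset_Ioi hc),
    integral_const_mul, integral_Ioi_rpow_of_lt (by linarith) hc₀, sub_add_cancel,
    Real.div_rpow ht.le hc₀.le, Real.rpow_neg hc₀.le]
  field_simp

lemma paretoMeasure_prod_real_mul_lt (ht : 0 < t) (hr : 0 < r) (hs : 1 ≤ s) :
    ((paretoMeasure t r).prod (paretoMeasure t r)).real {p | s * p.1 < p.2} = s ^ (-r) / 2 := by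
  have := isProbabilityMeasure_paretoMeasure ht hr
  have hs₀ : 0 < s := one_pos.trans_le hs
  have hmeas : MeasurableSet {p : ℝ × ℝ | s * p.1 < p.2} :=
    measurableSet_lt (by fun_prop) measurable_snd
  have htail : ∀ᵐ x ∂paretoMeasure t r,
      ∫ y, {p : ℝ × ℝ | s * p.1 < p.2}.indicator 1 (x, y) ∂paretoMeasure t r
        = (t / s) ^ r * x ^ (-r) := by
    filter_upwards [ae_le_paretoMeasure t r] with x hx
    have hx₀ : 0 < x := ht.trans_le hx
    rw [Real.rpow_neg hx₀.le, ← div_eq_mul_inv, ← Real.div_rpow (by positivity) hx₀.le, div_div,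
      ← paretoMeasure_real_Ioi ht hr (hx.trans (le_mul_of_one_le_left hx₀.le hs)),
      ← integral_indicator_one measurableSet_Ioi]
    rfl
  rw [← integral_indicator_one hmeas,
    integral_prod _ ((integrable_const 1).indicator hmeas), integral_congr_ae htail,
    integral_const_mul, integral_rpow_paretoMeasure ht hr.le (by linarith),
    Real.div_rpow ht.le hs₀.le, Real.rpow_neg ht.le, Real.rpow_neg hs₀.le]
  have := Real.rpow_pos_of_pos ht r
  field_simp
  norm_num

lemma ratioInd_eq_one_sub_indicator {x y : ℝ} (hx : 0 < x) (hy : 0 < y) (hs : 1 ≤ s) :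
    ratioInd x y s = 1 - {p : ℝ × ℝ | s * p.1 < p.2}.indicator 1 (x, y)
      - {p : ℝ × ℝ | s * p.1 < p.2}.indicator 1 (y, x) := by
  have hdisj : ¬ (s * x < y ∧ s * y < x) := fun h => by nlinarith [h.1, h.2]
  simp only [ratioInd, max_le_iff, div_le_iff₀ hx, div_le_iff₀ hy, Set.indicator_apply,
    Set.mem_ofPred_eq, Pi.one_apply]
  simp only [← not_lt]
  split_ifs <;> first | tauto | norm_num

lemma integral_ratioInd_prod (ht : 0 < t) (hr : 0 < r) (hs : 1 ≤ s) :
    ∫ p : ℝ × ℝ, ratioInd p.1 p.2 s ∂((paretoMeasure t r).prod (paretoMeasure t r))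
      = 1 - s ^ (-r) := by
  have := isProbabilityMeasure_paretoMeasure ht hr
  have hmeas : MeasurableSet {p : ℝ × ℝ | s * p.1 < p.2} :=
    measurableSet_lt (by fun_prop) measurable_snd
  have hind : Integrable ({p : ℝ × ℝ | s * p.1 < p.2}.indicator (1 : ℝ × ℝ → ℝ))
      ((paretoMeasure t r).prod (paretoMeasure t r)) := (integrable_const 1).indicator hmeas
  have hind_swap : Integrable
      (fun p : ℝ × ℝ => {p : ℝ × ℝ | s * p.1 < p.2}.indicator (1 : ℝ × ℝ → ℝ) p.swap)
      ((paretoMeasure t r).prod (paretoMeasure t r)) := hind.swap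
  have hratio : ∀ᵐ p ∂((paretoMeasure t r).prod (paretoMeasure t r)), ratioInd p.1 p.2 s
      = 1 - {p : ℝ × ℝ | s * p.1 < p.2}.indicator 1 p
        - {p : ℝ × ℝ | s * p.1 < p.2}.indicator 1 p.swap := by
    filter_upwards [Measure.quasiMeasurePreserving_fst.ae (ae_le_paretoMeasure t r),
      Measure.quasiMeasurePreserving_snd.ae (ae_le_paretoMeasure t r)] with p hx hy
    exact ratioInd_eq_one_sub_indicator (ht.trans_le hx) (ht.trans_le hy) hs
  rw [integral_congr_ae hratio, integral_sub (by fun_prop) hind_swap,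
    integral_sub (by fun_prop) hind, integral_prod_swap, integral_indicator_one hmeas,
    paretoMeasure_prod_real_mul_lt ht hr hs]
  simp
  ring

lemma integral_ratioInd_right (hα : 0 < α) {x y : ℝ} (hx : 0 < x) (hy : 0 < y) :
    ∫ z, ratioInd x y z ∂paretoMeasure 1 α = max (x / y) (y / x) ^ (-α) := by
  have hone : 1 ≤ max (x / y) (y / x) := by
    rcases le_total x y with h | h
    · exact le_max_of_le_right ((one_le_div hx).mpr h)
    · exact le_max_of_le_left ((one_le_div hy).mpr h)
  have hind : (fun z => ratioInd x y z) = (Set.Ici (max (x / y) (y / x))).indicator 1 := by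
    ext z
    simp only [ratioInd, Set.indicator_apply, Set.mem_Ici, Pi.one_apply]
  rw [hind, integral_indicator_one measurableSet_Ici, ← measureReal_congr Ioi_ae_eq_Ici,
    paretoMeasure_real_Ioi one_pos hα hone, one_div, Real.inv_rpow (by positivity),
    Real.rpow_neg (by positivity)]

lemma max_div_rpow_neg {x y : ℝ} (hx : 0 < x) (hxy : x ≤ y) (r : ℝ) :
    max (x / y) (y / x) ^ (-r) = x ^ r * y ^ (-r) := by
  have hy : 0 < y := hx.trans_le hxy
  rw [max_eq_right (((div_le_one hy).mpr hxy).trans ((one_le_div hx).mpr hxy)),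
    Real.div_rpow hy.le hx.le, Real.rpow_neg hx.le, div_inv_eq_mul, mul_comm]

lemma max_div_rpow_neg_mul_of_le {x y : ℝ} (hy : 0 < y) (hyx : y ≤ x) (r : ℝ) :
    max (x / y) (y / x) ^ (-r) * y ^ (-r - 1) = x ^ (-r) * y⁻¹ := by
  have hcancel : y ^ r * y ^ (-r - 1) = y⁻¹ := by
    rw [← Real.rpow_add hy, show r + (-r - 1) = -1 by ring, Real.rpow_neg_one]
  rw [max_comm, max_div_rpow_neg hy hyx]
  linear_combination x ^ (-r) * hcancel

lemma max_div_rpow_neg_mul_of_ge {x y : ℝ} (hx : 0 < x) (hxy : x ≤ y) (r : ℝ) :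
    max (x / y) (y / x) ^ (-r) * y ^ (-r - 1) = x ^ r * y ^ (-(2 * r) - 1) := by
  rw [max_div_rpow_neg hx hxy, show -(2 * r) - 1 = -r + (-r - 1) by ring,
    Real.rpow_add (hx.trans_le hxy), mul_assoc]

lemma integral_max_div_rpow (hα : 0 < α) (hs : 1 ≤ s) :
    ∫ y, max (s / y) (y / s) ^ (-α) ∂paretoMeasure 1 α
      = s ^ (-α) * (α * Real.log s) + s ^ (-α) / 2 := by
  have hs₀ : 0 < s := one_pos.trans_le hs
  have hlow : Set.EqOn (fun y => max (s / y) (y / s) ^ (-α) * (α * y ^ (-α - 1)))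
      (fun y => s ^ (-α) * α * y⁻¹) (Set.Ioc 1 s) := fun y hy => by
    linear_combination α * max_div_rpow_neg_mul_of_le (one_pos.trans hy.1) hy.2 α
  have hhigh : Set.EqOn (fun y => max (s / y) (y / s) ^ (-α) * (α * y ^ (-α - 1)))
      (fun y => s ^ α * α * y ^ (-(2 * α) - 1)) (Set.Ioi s) := fun y hy => by
    linear_combination α * max_div_rpow_neg_mul_of_ge hs₀ (Set.mem_Ioi.mp hy).le α
  have hinv : IntegrableOn (fun y : ℝ => y⁻¹) (Set.Ioc 1 s) :=
    ((continuousOn_inv₀.mono fun y hy => (one_pos.trans_le hy.1).ne').integrableOn_Icc).mono_set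
      Set.Ioc_subset_Icc_self
  have hlow_int : IntegrableOn (fun y => s ^ (-α) * α * y⁻¹) (Set.Ioc 1 s) :=
    hinv.const_mul _
  have hhigh_int : IntegrableOn (fun y => s ^ α * α * y ^ (-(2 * α) - 1)) (Set.Ioi s) :=
    (integrableOn_Ioi_rpow_of_lt (by linarith) hs₀).const_mul _
  rw [integral_paretoMeasure_one hα.le, ← Set.Ioc_union_Ioi_eq_Ioi hs,
    setIntegral_union (Set.Ioc_disjoint_Ioi le_rfl) measurableSet_Ioi
      (hlow_int.congr_fun hlow.symm measurableSet_Ioc)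
      (hhigh_int.congr_fun hhigh.symm measurableSet_Ioi),
    setIntegral_congr_fun measurableSet_Ioc hlow, setIntegral_congr_fun measurableSet_Ioi hhigh,
    integral_const_mul, integral_const_mul, ← intervalIntegral.integral_of_le hs,
    integral_inv_of_pos one_pos hs₀, integral_Ioi_rpow_of_lt (by linarith) hs₀, div_one,
    sub_add_cancel, show -(2 * α) = -α - α by ring, Real.rpow_sub hs₀]
  field_simp
  ring

lemma integrable_ratioInd {β : Type*} [MeasurableSpace β] {ν : Measure β} [IsFiniteMeasure ν]
    {f g h : β → ℝ} (hf : Measurable f) (hg : Measurable g) (hh : Measurable h) :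
    Integrable (fun b => ratioInd (f b) (g b) (h b)) ν :=
  .of_mem_Icc 0 1 (by fun_prop) (ae_of_all _ fun _ => ratioInd_mem_Icc _ _ _)

lemma integral_ratioInd_left_prod (hα : 0 < α) (hs : 1 ≤ s) :
    ∫ p : ℝ × ℝ, ratioInd s p.1 p.2 ∂((paretoMeasure 1 α).prod (paretoMeasure 1 α))
      = s ^ (-α) * (α * Real.log s) + s ^ (-α) / 2 := by
  have := isProbabilityMeasure_paretoMeasure one_pos hα
  rw [integral_prod _ (integrable_ratioInd measurable_const measurable_fst measurable_snd),
    ← integral_max_div_rpow hα hs]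
  refine integral_congr_ae ?_
  filter_upwards [ae_le_paretoMeasure 1 α] with y hy
  exact integral_ratioInd_right hα (one_pos.trans_le hs) (one_pos.trans_le hy)

lemma projection_eq {μ : Measure ℝ} [IsProbabilityMeasure μ] (s : ℝ) :
    projection μ s = 2 / 3 * ∫ p : ℝ × ℝ, ratioInd s p.1 p.2 ∂(μ.prod μ)
      + 1 / 3 * ∫ p : ℝ × ℝ, ratioInd p.1 p.2 s ∂(μ.prod μ) - 1 / 2 := by
  have hleft : Integrable (fun p : ℝ × ℝ => ratioInd s p.1 p.2) (μ.prod μ) :=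
    integrable_ratioInd measurable_const measurable_fst measurable_snd
  have hright : Integrable (fun p : ℝ × ℝ => ratioInd p.1 p.2 s) (μ.prod μ) :=
    integrable_ratioInd measurable_fst measurable_snd measurable_const
  have hswap : ∫ p : ℝ × ℝ, ratioInd s p.2 p.1 ∂(μ.prod μ)
      = ∫ p : ℝ × ℝ, ratioInd s p.1 p.2 ∂(μ.prod μ) :=
    integral_prod_swap fun p : ℝ × ℝ => ratioInd s p.1 p.2
  have hleft' : Integrable (fun p : ℝ × ℝ => ratioInd s p.2 p.1) (μ.prod μ) := hleft.swap
  simp only [projection, kernel]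
  rw [integral_sub (by fun_prop) (by fun_prop), integral_add (by fun_prop) (by fun_prop),
    integral_add (by fun_prop) (by fun_prop)]
  simp only [integral_const_mul, hswap, integral_const, probReal_univ, one_smul]
  ring

lemma projection_paretoMeasure (hα : 0 < α) (hs : 1 ≤ s) :
    projection (paretoMeasure 1 α) s = 2 / 3 * (α * Real.log s / s ^ α) - 1 / 6 := by
  have := isProbabilityMeasure_paretoMeasure one_pos hα
  rw [projection_eq, integral_ratioInd_left_prod hα hs, integral_ratioInd_prod one_pos hα hs,
    Real.rpow_neg (zero_le_one.trans hs)]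
  ring

lemma integral_projection_paretoMeasure (hα : 0 < α) :
    ∫ s, projection (paretoMeasure 1 α) s ∂paretoMeasure 1 α = 0 := by
  have hexpand : Set.EqOn (fun s => projection (paretoMeasure 1 α) s * (α * s ^ (-α - 1)))
      (fun s => 2 / 3 * α ^ 2 * (Real.log s ^ 1 * s ^ (-(2 * α) - 1))
        - α / 6 * (Real.log s ^ 0 * s ^ (-α - 1))) (Set.Ioi 1) := by
    intro s (hs : 1 < s)
    have hs₀ : 0 < s := one_pos.trans hs
    simp only
    rw [projection_paretoMeasure hα hs.le, show -(2 * α) - 1 = -α + (-α - 1) by ring,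
      Real.rpow_add hs₀, Real.rpow_neg hs₀.le]
    ring
  rw [integral_paretoMeasure_one hα.le, setIntegral_congr_fun measurableSet_Ioi hexpand,
    integral_sub ((integrableOn_Ioi_one_log_pow_mul_rpow 1 (by positivity)).const_mul _)
      ((integrableOn_Ioi_one_log_pow_mul_rpow 0 hα).const_mul _),
    integral_const_mul, integral_const_mul,
    integral_Ioi_one_log_pow_mul_rpow 1 (by positivity), integral_Ioi_one_log_pow_mul_rpow 0 hα]
  simp only [Nat.factorial]
  field_simp
  push_cast
  ring

lemma integral_projection_sq_paretoMeasure (hα : 0 < α) :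
    ∫ s, projection (paretoMeasure 1 α) s ^ 2 ∂paretoMeasure 1 α = 5 / 972 := by
  have hexpand : Set.EqOn (fun s => projection (paretoMeasure 1 α) s ^ 2 * (α * s ^ (-α - 1)))
      (fun s => 4 / 9 * α ^ 3 * (Real.log s ^ 2 * s ^ (-(3 * α) - 1))
        - 2 / 9 * α ^ 2 * (Real.log s ^ 1 * s ^ (-(2 * α) - 1))
        + α / 36 * (Real.log s ^ 0 * s ^ (-α - 1))) (Set.Ioi 1) := by
    intro s (hs : 1 < s)
    have hs₀ : 0 < s := one_pos.trans hs
    simp only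
    rw [projection_paretoMeasure hα hs.le, show -(2 * α) - 1 = -α + (-α - 1) by ring,
      show -(3 * α) - 1 = -α + (-α + (-α - 1)) by ring, Real.rpow_add hs₀, Real.rpow_add hs₀,
      Real.rpow_neg hs₀.le]
    ring
  have hint₂ := integrableOn_Ioi_one_log_pow_mul_rpow 2 (c := 3 * α) (by positivity)
  have hint₁ := integrableOn_Ioi_one_log_pow_mul_rpow 1 (c := 2 * α) (by positivity)
  have hint₀ := integrableOn_Ioi_one_log_pow_mul_rpow 0 hα
  rw [IntegrableOn] at hint₂ hint₁ hint₀
  rw [integral_paretoMeasure_one hα.le, setIntegral_congr_fun measurableSet_Ioi hexpand,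
    integral_add (by fun_prop) (by fun_prop), integral_sub (by fun_prop) (by fun_prop),
    integral_const_mul, integral_const_mul, integral_const_mul,
    integral_Ioi_one_log_pow_mul_rpow 2 (by positivity),
    integral_Ioi_one_log_pow_mul_rpow 1 (by positivity), integral_Ioi_one_log_pow_mul_rpow 0 hα]
  simp only [Nat.factorial]
  field_simp
  push_cast
  ring

end Pareto

section TestLimit

variable {Ω : Type*} [MeasurableSpace Ω] {P : Measure Ω} [IsProbabilityMeasure P]
  {X : ℕ → Ω → ℝ} {μ : Measure ℝ}

lemma memLp_vecKernel {ν : Measure (Fin 3 → ℝ)} [IsFiniteMeasure ν] (p : ℝ≥0∞) :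
    MemLp vecKernel p ν :=
  .of_bound measurable_vecKernel.aestronglyMeasurable (1 / 2)
    (ae_of_all _ fun _ => abs_kernel_le _ _ _)

lemma hoeffdingProjection_vecKernel (μ : Measure ℝ) [SigmaFinite μ] :
    hoeffdingProjection μ vecKernel = projection μ := by
  ext s
  exact (measurePreserving_finTwoArrow μ).integral_comp' fun p : ℝ × ℝ => kernel s p.1 p.2

lemma measurable_projection (μ : Measure ℝ) [IsProbabilityMeasure μ] :
    Measurable (projection μ) := by
  rw [← hoeffdingProjection_vecKernel]
  exact measurable_hoeffdingProjection measurable_vecKernel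

lemma condExp_kernel_ae_eq_projection (hmeas : ∀ i, Measurable (X i))
    (hlaw : ∀ i, P.map (X i) = μ) (hindep : iIndepFun X P) :
    P[fun ω => kernel (X 0 ω) (X 1 ω) (X 2 ω) | MeasurableSpace.comap (X 0) inferInstance]
      =ᵐ[P] fun ω => projection μ (X 0 ω) := by
  have hpair : P.map (fun ω => (X 1 ω, X 2 ω)) = μ.prod μ := by
    rw [(hindep.indepFun (by norm_num)).map_prod_eq_prod_map_map (hmeas 1).aemeasurable
      (hmeas 2).aemeasurable, hlaw, hlaw]
  have hkernel : Measurable fun p : ℝ × ℝ × ℝ => kernel p.1 p.2.1 p.2.2 := by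
    unfold kernel
    fun_prop
  have hint : Integrable (fun ω => kernel (X 0 ω) (X 1 ω) (X 2 ω)) P :=
    .of_bound (hkernel.comp (by fun_prop : Measurable fun ω => (X 0 ω, X 1 ω, X 2 ω))
      ).aestronglyMeasurable (1 / 2) (ae_of_all _ fun _ => abs_kernel_le _ _ _)
  have h := condExp_comap_ae_eq_integral_of_indepFun (hmeas 0) ((hmeas 1).prodMk (hmeas 2))
    (hindep.indepFun_prodMk hmeas 1 2 0 (by norm_num) (by norm_num)).symm
    hkernel.stronglyMeasurable hint
  rw [hpair] at h
  exact h

lemma tendstoInDistribution_sqrt_mul_testStat_sub [NullSingletonClass μ] {Ω' : Type*}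
    [MeasurableSpace Ω'] {P' : Measure Ω'} [IsProbabilityMeasure P'] {Y : Ω' → ℝ}
    (hmeas : ∀ i, Measurable (X i)) (hlaw : ∀ i, P.map (X i) = μ) (hindep : iIndepFun X P)
    (hone : ∀ᵐ x ∂μ, 1 ≤ x)
    (hY : HasLaw Y (gaussianReal 0 (9 * Var[projection μ; μ]).toNNReal) P') :
    TendstoInDistribution (fun (n : ℕ) ω => √(n : ℝ) * (testStat (fun i : Fin n => X i ω)
      - ∫ s, projection μ s ∂μ)) atTop Y (fun _ => P) P' := by
  have : IsProbabilityMeasure μ :=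
    hlaw 0 ▸ Measure.isProbabilityMeasure_map (hmeas 0).aemeasurable
  have hclt := tendstoInDistribution_sqrt_mul_uStatistic_sub hmeas hlaw hindep
    measurable_vecKernel (memLp_vecKernel 2) isSymmetric_vecKernel (Y := Y) (P' := P')
    (by rw [hoeffdingProjection_vecKernel]; norm_num; exact hY)
  rw [← integral_hoeffdingProjection measurable_vecKernel
    ((memLp_vecKernel 1).integrable le_rfl), hoeffdingProjection_vecKernel] at hclt
  refine tendstoInDistribution_of_tendstoInMeasure_sub _ _ hclt ?_ fun n => ?_
  · have hequiv := tendstoInMeasure_sqrt_mul_testStat_sub_uStat hmeas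
      (fun i => (hlaw i).symm ▸ ‹NullSingletonClass μ›)
      (fun i => ae_of_ae_map (hmeas i).aemeasurable ((hlaw i).symm ▸ hone)) hindep
    convert hequiv using 3 with n ω
    · simp only [Pi.sub_apply, uStat_eq_uStatistic]
      ring
    · rfl
  · exact (((measurable_testStat.comp (measurable_pi_lambda _ fun i => hmeas i)).sub_const
      _).const_mul _).aemeasurable

end TestLimit

end ParetoTest

theorem mainTheorem4 {Ω : Type*} [MeasurableSpace Ω] (P : Measure Ω) [IsProbabilityMeasure P]
    (α : ℝ) (hα : 0 < α) (X : ℕ → Ω → ℝ) (hmeas : ∀ i, Measurable (X i))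
    (hlaw : ∀ i, P.map (X i) = paretoMeasure 1 α) (hindep : iIndepFun X P) :
    -- the projection is the conditional expectation of the kernel given one argument
    (P[fun ω => ParetoTest.kernel (X 0 ω) (X 1 ω) (X 2 ω) |
        MeasurableSpace.comap (X 0) inferInstance]
      =ᵐ[P] fun ω => ParetoTest.projection (paretoMeasure 1 α) (X 0 ω)) ∧
    -- its explicit form
    (∀ s : ℝ, 1 ≤ s → ParetoTest.projection (paretoMeasure 1 α) s
      = 2 / 3 * (α * Real.log s / s ^ α) - 1 / 6) ∧
    -- it is centred, with variance `5/972`; in particular the kernel is non-degenerate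
    (∫ ω, ParetoTest.projection (paretoMeasure 1 α) (X 0 ω) ∂P = 0) ∧
    Var[fun ω => ParetoTest.projection (paretoMeasure 1 α) (X 0 ω); P] = 5 / 972 ∧
    (∫ s in Set.Ioi (1 : ℝ),
      ParetoTest.projection (paretoMeasure 1 α) s ^ 2 * (α * s ^ (-α - 1)) = 5 / 972) ∧
    0 < Var[fun ω => ParetoTest.projection (paretoMeasure 1 α) (X 0 ω); P] ∧
    -- asymptotic equivalence of the test statistic and the `U`-statistic of degree three
    TendstoInMeasure P
      (fun (n : ℕ) ω => √(n : ℝ) * (ParetoTest.testStat (fun i : Fin n => X i ω)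
        - ParetoTest.uStat (fun i : Fin n => X i ω)))
      atTop (fun _ => (0 : ℝ)) ∧
    -- asymptotic normality
    TendstoInDistribution
      (fun (n : ℕ) ω => √(n : ℝ) * ParetoTest.testStat (fun i : Fin n => X i ω))
      atTop (id : ℝ → ℝ) (fun _ => P) (gaussianReal 0 (5 / 108)) := by
  have := isProbabilityMeasure_paretoMeasure one_pos hα
  have hproj := ParetoTest.measurable_projection (paretoMeasure 1 α)
  have hcentred := ParetoTest.integral_projection_paretoMeasure hα
  have hsq := ParetoTest.integral_projection_sq_paretoMeasure hα
  have hone := ParetoTest.ae_le_paretoMeasure 1 α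
  have hmp : MeasurePreserving (X 0) P (paretoMeasure 1 α) := ⟨hmeas 0, hlaw 0⟩
  have hvar₀ : Var[ParetoTest.projection (paretoMeasure 1 α); paretoMeasure 1 α] = 5 / 972 := by
    rw [variance_of_integral_eq_zero hproj.aemeasurable hcentred, hsq]
  have hvar : Var[fun ω => ParetoTest.projection (paretoMeasure 1 α) (X 0 ω); P] = 5 / 972 := by
    rw [← hvar₀, ← hmp.variance_fun_comp hproj.aemeasurable]
  refine ⟨ParetoTest.condExp_kernel_ae_eq_projection hmeas hlaw hindep,
    fun s => ParetoTest.projection_paretoMeasure hα, ?_, hvar,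
    by rw [← ParetoTest.integral_paretoMeasure_one hα.le, hsq], by rw [hvar]; norm_num,
    ParetoTest.tendstoInMeasure_sqrt_mul_testStat_sub_uStat hmeas
      (fun i => (hlaw i).symm ▸ inferInstance)
      (fun i => ae_of_ae_map (hmeas i).aemeasurable ((hlaw i).symm ▸ hone)) hindep, ?_⟩
  · have hlaw₀ : HasLaw (X 0) (paretoMeasure 1 α) P := ⟨hmp.aemeasurable, hmp.map_eq⟩
    exact (hlaw₀.integral_comp hproj.aestronglyMeasurable).trans hcentred
  · have hlimit : (9 * (5 / 972 : ℝ)).toNNReal = 5 / 108 := by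
      rw [show (9 * (5 / 972) : ℝ) = ((5 / 108 : ℝ≥0) : ℝ) by norm_num, Real.toNNReal_coe]
    simpa only [hcentred, sub_zero] using
      ParetoTest.tendstoInDistribution_sqrt_mul_testStat_sub hmeas hlaw hindep hone
        (by rw [hvar₀, hlimit]; exact .id)
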